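/- Let \(k\ge 2\) and \(n\ge k^2-k+1\) be integers, and let \(G\) be a (simple, undirected) \(k\)-regular graph of order \(n\). Let \(\|G\|_*\) denote the energy of \(G\), that is, the sum of the absolute values of the eigenvalues (with multiplicity) of its adjacency matrix. Then \[ \|G\|_*\le\left(\sqrt{k-1}+\frac{1}{k+\sqrt{k-1}}\right)n . \] Equality holds if and only if \(G\) is a disjoint union of incidence graphs of projective planes of order \(k-1\) (the planes may be different), or \(k=2\) and \(G\) is a disjoint union of triangles and hexagons. Here the incidence graph of a projective plane is the bipartite graph whose vertices are the points and the lines of the plane, a point being adjacent to a line exactly when it lies on it. -/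

import Mathlib

universe u

/-- The energy of a finite graph: the sum of the absolute values of the eigenvalues, with
multiplicity, of its adjacency matrix. -/
noncomputable def SimpleGraph.energy {V : Type u} [Fintype V] [DecidableEq V]
    (G : SimpleGraph V) [DecidableRel G.Adj] : ℝ :=
  ∑ i, |(G.isHermitian_adjMatrix ℝ).eigenvalues i|

/-- The disjoint union of a family of graphs. -/
def SimpleGraph.disjointUnion {ι : Type u} {W : ι → Type u} (H : ∀ i, SimpleGraph (W i)) :
    SimpleGraph (Σ i, W i) where
  Adj x y := ∃ (i : ι) (a b : W i), x = ⟨i, a⟩ ∧ y = ⟨i, b⟩ ∧ (H i).Adj a b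
  symm := ⟨by
    rintro x y ⟨i, a, b, hx, hy, h⟩
    exact ⟨i, b, a, hy, hx, h.symm⟩⟩
  loopless := ⟨by
    rintro x ⟨i, a, b, rfl, hy, h⟩
    obtain rfl : a = b := eq_of_heq (Sigma.mk.inj hy).2
    exact h.ne rfl⟩

/-- `G` is (isomorphic to) a disjoint union of graphs that belong to the class `𝒞`. -/
def SimpleGraph.IsDisjointUnionOf {V : Type u} (𝒞 : ∀ W : Type u, SimpleGraph W → Prop)
    (G : SimpleGraph V) : Prop :=
  ∃ (ι : Type u) (W : ι → Type u) (H : ∀ i, SimpleGraph (W i)),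
    (∀ i, 𝒞 (W i) (H i)) ∧ Nonempty (G ≃g SimpleGraph.disjointUnion H)

/-- The incidence graph of points `P` and lines `L`: the bipartite graph on `P ⊕ L` in which a
point and a line are adjacent exactly when the point lies on the line. -/
def SimpleGraph.incidenceGraph (P L : Type u) [Membership P L] : SimpleGraph (P ⊕ L) where
  Adj x y := ∃ (p : P) (l : L), p ∈ l ∧
    ((x = Sum.inl p ∧ y = Sum.inr l) ∨ (x = Sum.inr l ∧ y = Sum.inl p))
  symm := ⟨by
    rintro x y ⟨p, l, h, h' | h'⟩
    · exact ⟨p, l, h, Or.inr ⟨h'.2, h'.1⟩⟩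
    · exact ⟨p, l, h, Or.inl ⟨h'.2, h'.1⟩⟩⟩
  loopless := ⟨by
    rintro x ⟨p, l, -, ⟨h₁, h₂⟩ | ⟨h₁, h₂⟩⟩
    · exact Sum.inl_ne_inr (h₁.symm.trans h₂)
    · exact Sum.inl_ne_inr (h₂.symm.trans h₁)⟩

/-- `H` is (isomorphic to) the incidence graph of a finite projective plane of order `q`.
Every projective plane has order at least `2` here; the degenerate plane of order `1`, the
triangle, is not counted as a projective plane. -/
def SimpleGraph.IsPlaneIncidenceGraph (q : ℕ) (W : Type u) (H : SimpleGraph W) : Prop :=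
  ∃ (P L : Type u) (_ : Finite P) (_ : Finite L) (_ : Membership P L)
    (_ : Configuration.ProjectivePlane P L),
    Configuration.ProjectivePlane.order P L = q ∧
      Nonempty (H ≃g SimpleGraph.incidenceGraph P L)

/-- `H` is a triangle or a hexagon. -/
def SimpleGraph.IsTriangleOrHexagon (W : Type u) (H : SimpleGraph W) : Prop :=
  Nonempty (H ≃g SimpleGraph.cycleGraph 3) ∨ Nonempty (H ≃g SimpleGraph.cycleGraph 6)

/-!
Put `s = √(k - 1)`. The even quartic that touches `|x|` at `|x| = s` and meets it at `|x| = k`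
majorizes `|x|` on `[-k, k]`, an interval containing the spectrum of `G`. Summing it over the
eigenvalues only involves `∑ λ² = n k` and `∑ λ⁴ = ∑ c(u, v)²`, where `c(u, v)` counts common
neighbours. Since `∑ c(u, v) = n k²` and `c(v, v) = k`, integrality gives `∑ λ⁴ ≥ n (2 k² - k)`,
which is the energy bound.

Equality forces `c(u, v) ≤ 1` for `u ≠ v` and `|λ| ∈ {s, k}`. In that case `A² - (k - 1) I` is the
zero-one matrix `L` of the relation of being equal or having a common neighbour. All row sums of `L`
equal `m = k² - k + 1` and the spectral condition reads `L² = m L`, which says that the relation is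
transitive. In a connected graph it then has at most two classes. If there is one, the counting
modulo a prime divisor of `k - 1` from the friendship theorem leaves only the triangle. If there are
two, they are the points and the lines of a projective plane of order `k - 1`, or of a triangle when
`k = 2`, whose incidence graph is the hexagon.
-/

namespace GraphEnergy

open SimpleGraph

section Spectral

open Polynomial

variable {n 𝕜 : Type*} [Fintype n] [DecidableEq n] [RCLike 𝕜] {A : Matrix n n 𝕜}

theorem trace_pow_eq_sum_eigenvalues_pow (hA : A.IsHermitian) (m : ℕ) :
    (A ^ m).trace = ∑ i, (hA.eigenvalues i : 𝕜) ^ m := by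
  rw [← cfc_pow_id (R := ℝ) A m hA.isSelfAdjoint, hA.cfc_eq, Matrix.IsHermitian.cfc,
    Unitary.conjStarAlgAut_apply, Matrix.trace_mul_comm, ← mul_assoc, Unitary.coe_star_mul_self,
    one_mul, Matrix.trace_diagonal]
  simp only [Function.comp_apply, RCLike.ofReal_pow]

theorem aeval_eq_zero_iff_eval_eigenvalues (hA : A.IsHermitian) (p : ℝ[X]) :
    aeval A p = 0 ↔ ∀ i, p.eval (hA.eigenvalues i) = 0 := by
  rw [← cfc_polynomial p A hA.isSelfAdjoint, ← cfc_zero (R := ℝ) A,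
    cfc_eq_cfc_iff_eqOn hA.isSelfAdjoint, hA.spectrum_real_eq_range_eigenvalues, Set.eqOn_range]
  exact funext_iff

end Spectral

section CommonNeighbors

variable {V : Type*} [Fintype V] (G : SimpleGraph V) [DecidableRel G.Adj]

theorem adjMatrix_mul_self_apply (R : Type*) [Semiring R] (u v : V) :
    (G.adjMatrix R * G.adjMatrix R) u v = (G.commonNeighbors u v).ncard := by
  have hset : G.commonNeighbors u v = {w ∈ G.neighborFinset u | G.Adj w v} := by
    ext w
    simp only [mem_commonNeighbors, adj_comm _ v, Finset.coe_filter, mem_neighborFinset,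
      Set.mem_ofPred_eq]
  simp only [adjMatrix_mul_apply, adjMatrix_apply, Finset.sum_boole, hset, Set.ncard_coe_finset]

theorem ncard_commonNeighbors_self (u : V) : (G.commonNeighbors u u).ncard = G.degree u := by
  rw [commonNeighbors_eq, Set.inter_self, ← card_neighborFinset_eq_degree,
    ← Set.ncard_coe_finset, coe_neighborFinset]

theorem sum_ncard_commonNeighbors (u : V) :
    ∑ v, (G.commonNeighbors u v).ncard = ∑ w ∈ G.neighborFinset u, G.degree w := by
  calc ∑ v, (G.commonNeighbors u v).ncard
      = ∑ v, ∑ w ∈ G.neighborFinset u, G.adjMatrix ℕ w v := by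
        simp only [← adjMatrix_mul_apply, adjMatrix_mul_self_apply, Nat.cast_id]
    _ = ∑ w ∈ G.neighborFinset u, G.degree w := by
        rw [Finset.sum_comm]
        simp only [adjMatrix_apply, Finset.sum_boole, Nat.cast_id, ← neighborFinset_eq_filter,
          card_neighborFinset_eq_degree]

variable [DecidableEq V]

theorem sum_eigenvalues_sq :
    ∑ i, (G.isHermitian_adjMatrix ℝ).eigenvalues i ^ 2 = ∑ v, (G.degree v : ℝ) := by
  have htrace := trace_pow_eq_sum_eigenvalues_pow (G.isHermitian_adjMatrix ℝ) 2
  simpa only [Matrix.trace, Matrix.diag_apply, sq, adjMatrix_mul_self_apply_self,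
    RCLike.ofReal_real_eq_id, id_eq] using htrace.symm

theorem sum_eigenvalues_pow_four :
    ∑ i, (G.isHermitian_adjMatrix ℝ).eigenvalues i ^ 4 =
      ∑ u, ∑ v, ((G.commonNeighbors u v).ncard : ℝ) ^ 2 := by
  have htrace := trace_pow_eq_sum_eigenvalues_pow (G.isHermitian_adjMatrix ℝ) 4
  simp only [RCLike.ofReal_real_eq_id, id_eq] at htrace
  calc ∑ i, (G.isHermitian_adjMatrix ℝ).eigenvalues i ^ 4
      = ((G.adjMatrix ℝ * G.adjMatrix ℝ) * (G.adjMatrix ℝ * G.adjMatrix ℝ)).trace := by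
        rw [← htrace, ← sq, ← sq, ← pow_mul]
    _ = ∑ u, ∑ v, (G.adjMatrix ℝ * G.adjMatrix ℝ) u v * (G.adjMatrix ℝ * G.adjMatrix ℝ) v u :=
        Finset.sum_congr rfl fun u _ => Matrix.mul_apply
    _ = ∑ u, ∑ v, ((G.commonNeighbors u v).ncard : ℝ) ^ 2 := by
        simp only [adjMatrix_mul_self_apply, G.commonNeighbors_symm _ _, sq]

theorem abs_eigenvalues_le_maxDegree (i : V) :
    |(G.isHermitian_adjMatrix ℝ).eigenvalues i| ≤ G.maxDegree := by
  have heigen : Module.End.HasEigenvalue (Matrix.toLin' (G.adjMatrix ℝ))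
      ((G.isHermitian_adjMatrix ℝ).eigenvalues i) := by
    refine Module.End.HasEigenvalue.of_mem_spectrum ?_
    rw [Matrix.spectrum_toLin']
    exact (G.isHermitian_adjMatrix ℝ).eigenvalues_mem_spectrum_real i
  obtain ⟨v, hv⟩ := eigenvalue_mem_ball heigen
  rw [mem_closedBall_iff_norm, adjMatrix_apply, if_neg (G.loopless.irrefl v), sub_zero,
    Real.norm_eq_abs] at hv
  calc |(G.isHermitian_adjMatrix ℝ).eigenvalues i|
      ≤ ∑ w ∈ Finset.univ.erase v, ‖G.adjMatrix ℝ v w‖ := hv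
    _ ≤ ∑ w, ‖G.adjMatrix ℝ v w‖ :=
        Finset.sum_le_univ_sum_of_nonneg fun _ => norm_nonneg _
    _ = G.degree v := by
        simp only [adjMatrix_apply, apply_ite norm, norm_one, norm_zero, Finset.sum_boole,
          ← neighborFinset_eq_filter, card_neighborFinset_eq_degree]
    _ ≤ G.maxDegree := by exact_mod_cast G.degree_le_maxDegree v

end CommonNeighbors

/-- Distinct vertices have at most one common neighbour, that is, the graph contains no cycle of
length four. -/
def QuadrilateralFree {V : Type*} (G : SimpleGraph V) : Prop :=
  Pairwise fun u v => (G.commonNeighbors u v).Subsingleton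

section QuadrilateralFree

variable {V : Type*} [Fintype V] (G : SimpleGraph V) [DecidableRel G.Adj]

theorem sum_ncard_commonNeighbors_add_degree_sq_le (u : V) :
    ∑ v, (G.commonNeighbors u v).ncard + G.degree u ^ 2 ≤
      ∑ v, (G.commonNeighbors u v).ncard ^ 2 + G.degree u := by
  classical
  have hle : ∑ v ∈ Finset.univ.erase u, (G.commonNeighbors u v).ncard ≤
      ∑ v ∈ Finset.univ.erase u, (G.commonNeighbors u v).ncard ^ 2 :=
    Finset.sum_le_sum fun v _ => Nat.le_self_pow two_ne_zero _
  rw [← Finset.add_sum_erase _ _ (Finset.mem_univ u), ncard_commonNeighbors_self,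
    ← Finset.add_sum_erase _ _ (Finset.mem_univ u), ncard_commonNeighbors_self]
  omega

theorem sum_ncard_commonNeighbors_add_degree_sq_eq_iff (u : V) :
    ∑ v, (G.commonNeighbors u v).ncard + G.degree u ^ 2 =
        ∑ v, (G.commonNeighbors u v).ncard ^ 2 + G.degree u ↔
      ∀ v, u ≠ v → (G.commonNeighbors u v).Subsingleton := by
  classical
  have heq : ∑ v ∈ Finset.univ.erase u, (G.commonNeighbors u v).ncard =
      ∑ v ∈ Finset.univ.erase u, (G.commonNeighbors u v).ncard ^ 2 ↔
        ∀ v, u ≠ v → (G.commonNeighbors u v).Subsingleton := by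
    rw [Finset.sum_eq_sum_iff_of_le fun v _ => Nat.le_self_pow two_ne_zero _]
    simp only [Finset.mem_erase, Finset.mem_univ, and_true, ← Set.ncard_le_one_iff_subsingleton,
      ne_comm]
    refine forall₂_congr fun v _ => ?_
    rw [Nat.le_one_iff_eq_zero_or_eq_one, ← IsIdempotentElem.iff_eq_zero_or_one,
      IsIdempotentElem, ← sq, eq_comm]
  rw [← heq, ← Finset.add_sum_erase _ _ (Finset.mem_univ u), ncard_commonNeighbors_self,
    ← Finset.add_sum_erase _ _ (Finset.mem_univ u), ncard_commonNeighbors_self]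
  omega

variable {G} {k : ℕ}

theorem sum_ncard_commonNeighbors_of_regular (hG : G.IsRegularOfDegree k) (u : V) :
    ∑ v, (G.commonNeighbors u v).ncard = k ^ 2 := by
  rw [sum_ncard_commonNeighbors, Finset.sum_congr rfl fun w _ => hG.degree_eq w,
    Finset.sum_const, card_neighborFinset_eq_degree, hG.degree_eq, smul_eq_mul, sq]

theorem le_sum_ncard_commonNeighbors_sq (hG : G.IsRegularOfDegree k) (u : V) :
    2 * k ^ 2 - k ≤ ∑ v, ((G.commonNeighbors u v).ncard : ℝ) ^ 2 := by
  have hu := sum_ncard_commonNeighbors_add_degree_sq_le G u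
  rw [sum_ncard_commonNeighbors_of_regular hG, hG.degree_eq, ← Nat.cast_le (α := ℝ)] at hu
  push_cast at hu
  linarith

theorem eq_sum_ncard_commonNeighbors_sq_iff (hG : G.IsRegularOfDegree k) (u : V) :
    2 * k ^ 2 - k = ∑ v, ((G.commonNeighbors u v).ncard : ℝ) ^ 2 ↔
      ∀ v, u ≠ v → (G.commonNeighbors u v).Subsingleton := by
  rw [← sum_ncard_commonNeighbors_add_degree_sq_eq_iff, sum_ncard_commonNeighbors_of_regular hG,
    hG.degree_eq, ← Nat.cast_inj (R := ℝ)]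
  push_cast
  rw [sub_eq_iff_eq_add, two_mul]

variable [DecidableEq V]

theorem le_sum_eigenvalues_pow_four (hG : G.IsRegularOfDegree k) :
    Fintype.card V * (2 * k ^ 2 - k : ℝ) ≤ ∑ i, (G.isHermitian_adjMatrix ℝ).eigenvalues i ^ 4 := by
  rw [sum_eigenvalues_pow_four, ← nsmul_eq_mul]
  exact Finset.card_nsmul_le_sum _ _ _ fun u _ => le_sum_ncard_commonNeighbors_sq hG u

theorem eq_sum_eigenvalues_pow_four_iff (hG : G.IsRegularOfDegree k) :
    Fintype.card V * (2 * k ^ 2 - k : ℝ) = ∑ i, (G.isHermitian_adjMatrix ℝ).eigenvalues i ^ 4 ↔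
      QuadrilateralFree G := by
  rw [sum_eigenvalues_pow_four, ← nsmul_eq_mul, ← Finset.card_univ, ← Finset.sum_const,
    Finset.sum_eq_sum_iff_of_le fun u _ => le_sum_ncard_commonNeighbors_sq hG u]
  exact forall_congr' fun u =>
    (forall_prop_of_true (Finset.mem_univ u)).trans (eq_sum_ncard_commonNeighbors_sq_iff hG u)

end QuadrilateralFree

section Majorant

/-- The even quartic in `x` that touches `|x|` at `|x| = s` and meets it at `|x| = k`; it reduces
the energy to the second and fourth spectral moments. -/
noncomputable def majorant (k s x : ℝ) : ℝ :=
  (-x ^ 4 + (k ^ 2 + 2 * k * s + 3 * s ^ 2) * x ^ 2 + s ^ 2 * (k ^ 2 + 2 * k * s)) /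
    (2 * s * (k + s) ^ 2)

variable {k s x : ℝ}

theorem majorant_sub_abs (hs : s ≠ 0) (hks : k + s ≠ 0) :
    majorant k s x - |x| =
      (|x| - s) ^ 2 * ((k - |x|) * (|x| + 2 * s + k)) / (2 * s * (k + s) ^ 2) := by
  have hx4 : x ^ 4 = |x| ^ 4 := (Even.pow_abs (by decide) x).symm
  rw [majorant, hx4, ← sq_abs x]
  field_simp
  ring

theorem abs_le_majorant (hs : 0 < s) (hx : |x| ≤ k) : |x| ≤ majorant k s x := by
  have hk : 0 ≤ k := (abs_nonneg x).trans hx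
  have : 0 ≤ k - |x| := sub_nonneg.2 hx
  rw [← sub_nonneg, majorant_sub_abs hs.ne' (by positivity)]
  positivity

theorem abs_eq_majorant_iff (hs : 0 < s) (hk : 0 ≤ k) :
    |x| = majorant k s x ↔ |x| = s ∨ |x| = k := by
  have hpos : 0 < |x| + 2 * s + k := by positivity
  have hden : 0 < 2 * s * (k + s) ^ 2 := by positivity
  rw [eq_comm, ← sub_eq_zero, majorant_sub_abs hs.ne' (by positivity), div_eq_zero_iff,
    or_iff_left hden.ne', mul_eq_zero, mul_eq_zero, or_iff_left hpos.ne', sq_eq_zero_iff,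
    sub_eq_zero, sub_eq_zero, eq_comm (a := k)]

end Majorant

section EnergyBound

variable {V : Type*} [Fintype V] [DecidableEq V] {G : SimpleGraph V} [DecidableRel G.Adj]
  {k : ℕ} {s : ℝ}

theorem sum_majorant_eigenvalues (hG : G.IsRegularOfDegree k) (hs : 0 < s) (hsk : s ^ 2 = k - 1) :
    ∑ i, majorant k s ((G.isHermitian_adjMatrix ℝ).eigenvalues i) =
      (s + 1 / (k + s)) * Fintype.card V -
        (∑ i, (G.isHermitian_adjMatrix ℝ).eigenvalues i ^ 4 -
          Fintype.card V * (2 * k ^ 2 - k)) / (2 * s * (k + s) ^ 2) := by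
  have hsq : ∑ i, (G.isHermitian_adjMatrix ℝ).eigenvalues i ^ 2 = Fintype.card V * k := by
    simp only [sum_eigenvalues_sq, hG.degree_eq, Finset.sum_const, Finset.card_univ, nsmul_eq_mul]
  have hk : (k : ℝ) = s ^ 2 + 1 := by linarith
  simp only [majorant]
  rw [← Finset.sum_div, Finset.sum_add_distrib, Finset.sum_add_distrib, Finset.sum_neg_distrib,
    ← Finset.mul_sum, hsq, Finset.sum_const, Finset.card_univ, nsmul_eq_mul, hk]
  field_simp
  ring

theorem sum_majorant_eigenvalues_le (hG : G.IsRegularOfDegree k) (hs : 0 < s)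
    (hsk : s ^ 2 = k - 1) :
    ∑ i, majorant k s ((G.isHermitian_adjMatrix ℝ).eigenvalues i) ≤
      (s + 1 / (k + s)) * Fintype.card V := by
  rw [sum_majorant_eigenvalues hG hs hsk]
  have := sub_nonneg.2 (le_sum_eigenvalues_pow_four hG)
  exact sub_le_self _ (by positivity)

theorem sum_majorant_eigenvalues_eq_iff (hG : G.IsRegularOfDegree k) (hs : 0 < s)
    (hsk : s ^ 2 = k - 1) :
    ∑ i, majorant k s ((G.isHermitian_adjMatrix ℝ).eigenvalues i) =
      (s + 1 / (k + s)) * Fintype.card V ↔ QuadrilateralFree G := by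
  have hden : 2 * s * (k + s) ^ 2 ≠ 0 := by positivity
  rw [sum_majorant_eigenvalues hG hs hsk, sub_eq_self, div_eq_zero_iff, or_iff_left hden,
    sub_eq_zero, eq_comm, eq_sum_eigenvalues_pow_four_iff hG]

theorem abs_eigenvalues_le_majorant (hG : G.IsRegularOfDegree k) (hs : 0 < s) (i : V) :
    |(G.isHermitian_adjMatrix ℝ).eigenvalues i| ≤
      majorant k s ((G.isHermitian_adjMatrix ℝ).eigenvalues i) := by
  have : Nonempty V := ⟨i⟩
  exact abs_le_majorant hs (hG.maxDegree_eq ▸ abs_eigenvalues_le_maxDegree G i)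

theorem energy_le (hG : G.IsRegularOfDegree k) (hs : 0 < s) (hsk : s ^ 2 = k - 1) :
    G.energy ≤ (s + 1 / (k + s)) * Fintype.card V :=
  (Finset.sum_le_sum fun i _ => abs_eigenvalues_le_majorant hG hs i).trans
    (sum_majorant_eigenvalues_le hG hs hsk)

theorem energy_eq_iff_abs_eigenvalues (hG : G.IsRegularOfDegree k) (hs : 0 < s)
    (hsk : s ^ 2 = k - 1) :
    G.energy = (s + 1 / (k + s)) * Fintype.card V ↔ QuadrilateralFree G ∧
      ∀ i, |(G.isHermitian_adjMatrix ℝ).eigenvalues i| = s ∨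
        |(G.isHermitian_adjMatrix ℝ).eigenvalues i| = k := by
  have hle : G.energy ≤ ∑ i, majorant k s ((G.isHermitian_adjMatrix ℝ).eigenvalues i) :=
    Finset.sum_le_sum fun i _ => abs_eigenvalues_le_majorant hG hs i
  have htouch : G.energy = ∑ i, majorant k s ((G.isHermitian_adjMatrix ℝ).eigenvalues i) ↔
      ∀ i, |(G.isHermitian_adjMatrix ℝ).eigenvalues i| = s ∨
        |(G.isHermitian_adjMatrix ℝ).eigenvalues i| = k := by
    rw [energy, Finset.sum_eq_sum_iff_of_le fun i _ => abs_eigenvalues_le_majorant hG hs i]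
    simp only [Finset.mem_univ, true_imp_iff, abs_eq_majorant_iff hs k.cast_nonneg]
  rw [← htouch, ← sum_majorant_eigenvalues_eq_iff hG hs hsk]
  constructor
  · intro heq
    have hmajorant := (sum_majorant_eigenvalues_le hG hs hsk).antisymm (heq ▸ hle)
    exact ⟨hmajorant, heq.trans hmajorant.symm⟩
  · rintro ⟨hmajorant, heq⟩
    exact heq.trans hmajorant

end EnergyBound

section RelMatrix

variable {V R : Type*} {r : V → V → Prop}

open Classical in
/-- The zero-one matrix of a relation, which, unlike an adjacency matrix, need not be
irreflexive. -/
noncomputable def relMatrix (R : Type*) [Zero R] [One R] (r : V → V → Prop) : Matrix V V R :=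
  Matrix.of fun u v => if r u v then 1 else 0

variable [Fintype V] [NonAssocSemiring R]

theorem relMatrix_mul_self_apply (u v : V) :
    (relMatrix R r * relMatrix R r) u v = ({w | r u w ∧ r w v}.ncard : R) := by
  classical
  simp only [Matrix.mul_apply, relMatrix, Matrix.of_apply, mul_ite, mul_one, mul_zero, ← ite_and,
    Finset.sum_boole, and_comm, ← Set.ncard_coe_finset, Finset.coe_filter, Finset.mem_univ,
    true_and]

theorem relMatrix_mul_self_eq_smul_iff [CharZero R] {m : ℕ} (hsymm : ∀ ⦃u v⦄, r u v → r v u)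
    (hm : ∀ u, {v | r u v}.ncard = m) :
    relMatrix R r * relMatrix R r = (m : R) • relMatrix R r ↔
      ∀ ⦃u v w⦄, r u v → r v w → r u w := by
  constructor
  · intro hsq u v w huv hvw
    have hcard : ({x | r v x ∧ r x u}.ncard : R) = m := by
      rw [← relMatrix_mul_self_apply, hsq, Matrix.smul_apply, relMatrix, Matrix.of_apply,
        if_pos (hsymm huv), smul_eq_mul, mul_one]
    have hall : {x | r v x ∧ r x u} = {x | r v x} :=
      Set.eq_of_subset_of_ncard_le (fun x hx => hx.1) (by rw [hm, Nat.cast_inj.1 hcard])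
    exact hsymm (hall.ge hvw).2
  · intro htrans
    ext u v
    rw [relMatrix_mul_self_apply, Matrix.smul_apply, relMatrix, Matrix.of_apply, smul_eq_mul,
      mul_ite, mul_one, mul_zero]
    split_ifs with huv
    · rw [← hm u]
      congr 2
      ext w
      exact and_iff_left_of_imp fun huw => htrans (hsymm huw) huv
    · have hempty : {w | r u w ∧ r w v} = ∅ :=
        Set.eq_empty_of_forall_notMem fun w hw => huv (htrans hw.1 hw.2)
      rw [hempty, Set.ncard_empty, Nat.cast_zero]

end RelMatrix

/-- Two vertices are linked if they are equal or have a common neighbour. In the incidence graph of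
a projective plane this separates the points from the lines. -/
def Linked {V : Type*} (G : SimpleGraph V) (u v : V) : Prop :=
  u = v ∨ (G.commonNeighbors u v).Nonempty

/-- The common local structure of incidence graphs of projective planes, triangles and hexagons:
two distinct vertices have at most one common neighbour, and being linked is an equivalence
relation. -/
structure IsPlaneLike {V : Type*} (G : SimpleGraph V) : Prop where
  quadrilateralFree : QuadrilateralFree G
  linked_trans : ∀ ⦃u v w⦄, Linked G u v → Linked G v w → Linked G u w

section Linked

variable {V : Type*} {G : SimpleGraph V} {u v w : V}

theorem Linked.refl (v : V) : Linked G v v := Or.inl rfl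

theorem Linked.of_adj_of_adj (hu : G.Adj u w) (hv : G.Adj v w) : Linked G u v := Or.inr ⟨w, hu, hv⟩

theorem Linked.symm (h : Linked G u v) : Linked G v u :=
  h.imp Eq.symm fun hne => G.commonNeighbors_symm u v ▸ hne

variable [Fintype V] [DecidableRel G.Adj] {k : ℕ}

theorem adjMatrix_mul_self_of_regular (R : Type*) [Ring R] [DecidableEq V]
    (hG : G.IsRegularOfDegree k) (h : QuadrilateralFree G) :
    G.adjMatrix R * G.adjMatrix R = relMatrix R (Linked G) + ((k : R) - 1) • 1 := by
  ext u v
  rw [adjMatrix_mul_self_apply, Matrix.add_apply, relMatrix, Matrix.of_apply, Matrix.smul_apply,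
    Matrix.one_apply, smul_eq_mul]
  split_ifs with hlinked huv huv
  · rw [huv, ncard_commonNeighbors_self, hG.degree_eq, mul_one, add_sub_cancel]
  · have hone : (G.commonNeighbors u v).ncard = 1 :=
      (Set.ncard_le_one_iff_subsingleton.2 (h huv)).antisymm
        ((Set.ncard_pos (Set.toFinite _)).2 (hlinked.resolve_left huv))
    rw [hone, Nat.cast_one, mul_zero, add_zero]
  · exact absurd (Or.inl huv) hlinked
  · rw [Set.not_nonempty_iff_eq_empty.1 (not_or.1 hlinked).2, Set.ncard_empty, Nat.cast_zero,
      mul_zero, add_zero]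

theorem ncard_linked_add (hG : G.IsRegularOfDegree k) (h : QuadrilateralFree G) (u : V) :
    {v | Linked G u v}.ncard + k = k ^ 2 + 1 := by
  classical
  have hrow : ∑ v, ((G.commonNeighbors u v).ncard : ℝ) =
      {v | Linked G u v}.ncard + ((k : ℝ) - 1) := by
    simp only [← adjMatrix_mul_self_apply, adjMatrix_mul_self_of_regular ℝ hG h, Matrix.add_apply,
      relMatrix, Matrix.of_apply, Matrix.smul_apply, Matrix.one_apply, smul_eq_mul,
      Finset.sum_add_distrib, Finset.sum_boole, mul_ite, mul_one, mul_zero, Finset.sum_ite_eq,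
      Finset.mem_univ, if_true, ← Set.ncard_coe_finset, Finset.coe_filter, true_and]
  rw [← Nat.cast_sum, sum_ncard_commonNeighbors_of_regular hG] at hrow
  rw [← Nat.cast_inj (R := ℝ)]
  push_cast at hrow ⊢
  linarith

variable [DecidableEq V]

open Polynomial in
theorem abs_eigenvalues_iff_linked_trans (hG : G.IsRegularOfDegree k) (h : QuadrilateralFree G)
    {s : ℝ} (hs : 0 < s) (hsk : s ^ 2 = k - 1) :
    (∀ i, |(G.isHermitian_adjMatrix ℝ).eigenvalues i| = s ∨
        |(G.isHermitian_adjMatrix ℝ).eigenvalues i| = k) ↔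
      ∀ ⦃u v w⦄, Linked G u v → Linked G v w → Linked G u w := by
  set p : ℝ[X] := (X ^ 2 - C ((k : ℝ) - 1)) * (X ^ 2 - C ((k : ℝ) ^ 2)) with hp
  have hroots (x : ℝ) : |x| = s ∨ |x| = k ↔ p.eval x = 0 := by
    simp only [hp, eval_mul, eval_sub, eval_pow, eval_X, eval_C, mul_eq_zero, sub_eq_zero, ← hsk,
      sq_eq_sq_iff_abs_eq_abs, abs_of_pos hs, Nat.abs_cast]
  obtain ⟨m, hm⟩ : ∃ m : ℕ, m + k = k ^ 2 + 1 :=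
    ⟨k ^ 2 + 1 - k, Nat.sub_add_cancel (by nlinarith)⟩
  have hpA : aeval (G.adjMatrix ℝ) p = relMatrix ℝ (Linked G) * relMatrix ℝ (Linked G) -
      (m : ℝ) • relMatrix ℝ (Linked G) := by
    have hmk : (m : ℝ) = k ^ 2 - (k - 1) := by
      have : (m : ℝ) + k = k ^ 2 + 1 := by exact_mod_cast hm
      linarith
    have hfactor (c : ℝ) : aeval (G.adjMatrix ℝ) (X ^ 2 - C c) =
        relMatrix ℝ (Linked G) + ((k : ℝ) - 1) • 1 - c • 1 := by
      rw [map_sub, map_pow, aeval_X, aeval_C, Algebra.algebraMap_eq_smul_one, sq,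
        adjMatrix_mul_self_of_regular ℝ hG h]
    rw [hp, map_mul, hfactor, hfactor, add_sub_cancel_right, add_sub_assoc, ← sub_smul, hmk,
      mul_add, mul_smul_comm, mul_one, sub_eq_add_neg _ (_ • _), ← neg_smul, neg_sub]
  rw [← relMatrix_mul_self_eq_smul_iff (R := ℝ) (m := m) (fun _ _ => Linked.symm) fun u => by
    have := ncard_linked_add hG h u
    omega]
  rw [← sub_eq_zero, ← hpA, aeval_eq_zero_iff_eval_eigenvalues (G.isHermitian_adjMatrix ℝ)]
  exact forall_congr' fun i => hroots _

theorem energy_eq_iff_isPlaneLike (hG : G.IsRegularOfDegree k) {s : ℝ} (hs : 0 < s)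
    (hsk : s ^ 2 = k - 1) :
    G.energy = (s + 1 / (k + s)) * Fintype.card V ↔ IsPlaneLike G := by
  rw [energy_eq_iff_abs_eigenvalues hG hs hsk]
  constructor
  · rintro ⟨h, heigen⟩
    exact ⟨h, (abs_eigenvalues_iff_linked_trans hG h hs hsk).1 heigen⟩
  · rintro ⟨h, htrans⟩
    exact ⟨h, (abs_eigenvalues_iff_linked_trans hG h hs hsk).2 htrans⟩

end Linked

section Iso

variable {V W : Type*} {G : SimpleGraph V} {H : SimpleGraph W}

theorem commonNeighbors_apply_iso (f : G ≃g H) (u v : V) :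
    H.commonNeighbors (f u) (f v) = f '' G.commonNeighbors u v := by
  ext w
  obtain ⟨w, rfl⟩ := f.surjective w
  simp only [f.injective.mem_set_image, mem_commonNeighbors, f.map_adj_iff]

theorem linked_apply_iso (f : G ≃g H) {u v : V} : Linked H (f u) (f v) ↔ Linked G u v := by
  rw [Linked, Linked, commonNeighbors_apply_iso, Set.image_nonempty, f.injective.eq_iff]

theorem QuadrilateralFree.of_iso (h : QuadrilateralFree H) (f : G ≃g H) : QuadrilateralFree G :=
  fun u v huv => f.injective.subsingleton_image_iff.1 <|
    commonNeighbors_apply_iso f u v ▸ h (f.injective.ne huv)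

theorem IsPlaneLike.of_iso (h : IsPlaneLike H) (f : G ≃g H) : IsPlaneLike G where
  quadrilateralFree := h.quadrilateralFree.of_iso f
  linked_trans _ _ _ huv hvw := (linked_apply_iso f).1 <|
    h.linked_trans ((linked_apply_iso f).2 huv) ((linked_apply_iso f).2 hvw)

end Iso

section DisjointUnion

variable {ι : Type u} {W : ι → Type u} {K : ∀ i, SimpleGraph (W i)} {i : ι}

theorem disjointUnion_adj_mk {a : W i} {y : Σ i, W i} :
    (disjointUnion K).Adj ⟨i, a⟩ y ↔ ∃ b, y = ⟨i, b⟩ ∧ (K i).Adj a b := by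
  constructor
  · rintro ⟨j, a', b, h, rfl, hab⟩
    cases h
    exact ⟨b, rfl, hab⟩
  · rintro ⟨b, rfl, hab⟩
    exact ⟨i, a, b, rfl, rfl, hab⟩

theorem commonNeighbors_disjointUnion (a b : W i) :
    (disjointUnion K).commonNeighbors ⟨i, a⟩ ⟨i, b⟩ = Sigma.mk i '' (K i).commonNeighbors a b := by
  ext z
  simp only [mem_commonNeighbors, disjointUnion_adj_mk, Set.mem_image]
  constructor
  · rintro ⟨⟨c, rfl, hac⟩, d, hd, hbd⟩
    cases hd
    exact ⟨c, ⟨hac, hbd⟩, rfl⟩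
  · rintro ⟨c, ⟨hac, hbc⟩, rfl⟩
    exact ⟨⟨c, rfl, hac⟩, c, rfl, hbc⟩

theorem linked_disjointUnion_mk {a : W i} {y : Σ i, W i} :
    Linked (disjointUnion K) ⟨i, a⟩ y ↔ ∃ b, y = ⟨i, b⟩ ∧ Linked (K i) a b := by
  constructor
  · rintro (rfl | ⟨z, haz, hyz⟩)
    · exact ⟨a, rfl, .refl a⟩
    · obtain ⟨c, rfl, hac⟩ := disjointUnion_adj_mk.1 haz
      obtain ⟨b, rfl, hcb⟩ := disjointUnion_adj_mk.1 (adj_symm _ hyz)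
      exact ⟨b, rfl, .of_adj_of_adj hac hcb.symm⟩
  · rintro ⟨b, rfl, rfl | hab⟩
    · exact .refl _
    · exact Or.inr (commonNeighbors_disjointUnion a b ▸ hab.image _)

theorem isPlaneLike_disjointUnion_iff :
    IsPlaneLike (disjointUnion K) ↔ ∀ i, IsPlaneLike (K i) := by
  constructor
  · refine fun h i => ⟨fun a b hab => ?_, fun a b c hab hbc => ?_⟩
    · refine sigma_mk_injective.subsingleton_image_iff.1 ?_
      rw [← commonNeighbors_disjointUnion]
      exact h.quadrilateralFree (sigma_mk_injective.ne hab)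
    · obtain ⟨_, hc, hac⟩ := linked_disjointUnion_mk.1 <|
        h.linked_trans (linked_disjointUnion_mk.2 ⟨b, rfl, hab⟩)
          (linked_disjointUnion_mk.2 ⟨c, rfl, hbc⟩)
      cases hc
      exact hac
  · refine fun h => ⟨?_, ?_⟩
    · rintro ⟨i, a⟩ y hne z hz
      obtain ⟨b, rfl, -⟩ := linked_disjointUnion_mk.1 (.of_adj_of_adj hz.1 hz.2)
      rw [commonNeighbors_disjointUnion] at hz ⊢
      exact ((h i).quadrilateralFree fun hab => hne (congrArg _ hab)).image _ hz
    · rintro ⟨i, a⟩ y z hay hyz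
      obtain ⟨b, rfl, hab⟩ := linked_disjointUnion_mk.1 hay
      obtain ⟨c, rfl, hbc⟩ := linked_disjointUnion_mk.1 hyz
      exact linked_disjointUnion_mk.2 ⟨c, rfl, (h i).linked_trans hab hbc⟩

end DisjointUnion

section IncidenceGraph

variable {P L : Type u} [Membership P L] {p q : P} {l m : L}

theorem incidenceGraph_adj_inl_inr : (incidenceGraph P L).Adj (.inl p) (.inr l) ↔ p ∈ l := by
  simp [incidenceGraph]

theorem incidenceGraph_adj_inr_inl : (incidenceGraph P L).Adj (.inr l) (.inl p) ↔ p ∈ l := by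
  rw [adj_comm, incidenceGraph_adj_inl_inr]

theorem not_incidenceGraph_adj_inl_inl : ¬(incidenceGraph P L).Adj (.inl p) (.inl q) := by
  simp [incidenceGraph]

theorem not_incidenceGraph_adj_inr_inr : ¬(incidenceGraph P L).Adj (.inr l) (.inr m) := by
  simp [incidenceGraph]

theorem commonNeighbors_incidenceGraph_inl_inl (p q : P) :
    (incidenceGraph P L).commonNeighbors (.inl p) (.inl q) = Sum.inr '' {l | p ∈ l ∧ q ∈ l} := by
  ext (r | l) <;>
    simp [mem_commonNeighbors, incidenceGraph_adj_inl_inr, not_incidenceGraph_adj_inl_inl]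

theorem commonNeighbors_incidenceGraph_inr_inr (l m : L) :
    (incidenceGraph P L).commonNeighbors (.inr l) (.inr m) = Sum.inl '' {p | p ∈ l ∧ p ∈ m} := by
  ext (p | n) <;>
    simp [mem_commonNeighbors, incidenceGraph_adj_inr_inl, not_incidenceGraph_adj_inr_inr]

theorem commonNeighbors_incidenceGraph_inl_inr (p : P) (l : L) :
    (incidenceGraph P L).commonNeighbors (.inl p) (.inr l) = ∅ := by
  ext (q | m) <;> simp [mem_commonNeighbors, not_incidenceGraph_adj_inl_inl,
    not_incidenceGraph_adj_inr_inr]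

theorem linked_incidenceGraph_inl_inl :
    Linked (incidenceGraph P L) (.inl p) (.inl q) ↔ p = q ∨ ∃ l : L, p ∈ l ∧ q ∈ l := by
  rw [Linked, Sum.inl_injective.eq_iff, commonNeighbors_incidenceGraph_inl_inl, Set.image_nonempty]
  rfl

theorem linked_incidenceGraph_inr_inr :
    Linked (incidenceGraph P L) (.inr l) (.inr m) ↔ l = m ∨ ∃ p : P, p ∈ l ∧ p ∈ m := by
  rw [Linked, Sum.inr_injective.eq_iff, commonNeighbors_incidenceGraph_inr_inr, Set.image_nonempty]
  rfl

theorem not_linked_incidenceGraph_inl_inr :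
    ¬Linked (incidenceGraph P L) (.inl p) (.inr l) := by
  simp [Linked, commonNeighbors_incidenceGraph_inl_inr]

theorem quadrilateralFree_incidenceGraph_iff :
    QuadrilateralFree (incidenceGraph P L) ↔
      ∀ {p q : P} {l m : L}, p ∈ l → q ∈ l → p ∈ m → q ∈ m → p = q ∨ l = m := by
  constructor
  · intro h p q l m hpl hql hpm hqm
    refine or_iff_not_imp_left.2 fun hpq => ?_
    have hset : ((incidenceGraph P L).commonNeighbors (.inl p) (.inl q)).Subsingleton :=
      h (Sum.inl_injective.ne hpq)
    rw [commonNeighbors_incidenceGraph_inl_inl] at hset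
    exact Sum.inr_injective.subsingleton_image_iff.1 hset ⟨hpl, hql⟩ ⟨hpm, hqm⟩
  · rintro h (p | l) (q | m) hne
    · rw [commonNeighbors_incidenceGraph_inl_inl]
      exact Set.Subsingleton.image (fun l hl m hm =>
        (h hl.1 hl.2 hm.1 hm.2).resolve_left (hne <| congrArg _ ·)) _
    · exact commonNeighbors_incidenceGraph_inl_inr p m ▸ Set.subsingleton_empty
    · rw [commonNeighbors_symm, commonNeighbors_incidenceGraph_inl_inr]
      exact Set.subsingleton_empty
    · rw [commonNeighbors_incidenceGraph_inr_inr]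
      exact Set.Subsingleton.image (fun p hp q hq =>
        (h hp.1 hq.1 hp.2 hq.2).resolve_right (hne <| congrArg _ ·)) _

end IncidenceGraph

section Examples

theorem linked_incidenceGraph_iff {P L : Type u} [Membership P L]
    [Configuration.ProjectivePlane P L] {x y : P ⊕ L} :
    Linked (incidenceGraph P L) x y ↔ x.isLeft = y.isLeft := by
  rcases x with p | l <;> rcases y with q | m
  · refine iff_of_true (linked_incidenceGraph_inl_inl.2 ?_) rfl
    exact or_iff_not_imp_left.2 fun hpq => ⟨_, Configuration.HasLines.mkLine_ax hpq⟩
  · exact iff_of_false not_linked_incidenceGraph_inl_inr Bool.true_eq_false_eq_False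
  · exact iff_of_false (fun h => not_linked_incidenceGraph_inl_inr h.symm)
      Bool.false_eq_true_eq_False
  · refine iff_of_true (linked_incidenceGraph_inr_inr.2 ?_) rfl
    exact or_iff_not_imp_left.2 fun hlm => ⟨_, Configuration.HasPoints.mkPoint_ax hlm⟩

theorem isPlaneLike_incidenceGraph (P L : Type u) [Membership P L]
    [Configuration.ProjectivePlane P L] : IsPlaneLike (incidenceGraph P L) where
  quadrilateralFree :=
    quadrilateralFree_incidenceGraph_iff.2 Configuration.Nondegenerate.eq_or_eq
  linked_trans _ _ _ hxy hyz :=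
    linked_incidenceGraph_iff.2 <|
      (linked_incidenceGraph_iff.1 hxy).trans (linked_incidenceGraph_iff.1 hyz)

theorem isPlaneLike_of_isPlaneIncidenceGraph {q : ℕ} {W : Type u} {H : SimpleGraph W}
    (h : IsPlaneIncidenceGraph q W H) : IsPlaneLike H := by
  obtain ⟨P, L, -, -, _, _, -, ⟨f⟩⟩ := h
  exact (isPlaneLike_incidenceGraph P L).of_iso f

theorem isPlaneLike_cycleGraph_three : IsPlaneLike (cycleGraph 3) := by
  constructor
  · unfold QuadrilateralFree Pairwise Set.Subsingleton
    simp only [mem_commonNeighbors]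
    decide
  · unfold Linked Set.Nonempty
    simp only [mem_commonNeighbors]
    decide

theorem isPlaneLike_cycleGraph_six : IsPlaneLike (cycleGraph 6) := by
  constructor
  · unfold QuadrilateralFree Pairwise Set.Subsingleton
    simp only [mem_commonNeighbors]
    decide +kernel
  · unfold Linked Set.Nonempty
    simp only [mem_commonNeighbors]
    decide +kernel

theorem isPlaneLike_of_isTriangleOrHexagon {W : Type u} {H : SimpleGraph W}
    (h : IsTriangleOrHexagon W H) : IsPlaneLike H := by
  rcases h with ⟨⟨f⟩⟩ | ⟨⟨f⟩⟩
  · exact isPlaneLike_cycleGraph_three.of_iso f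
  · exact isPlaneLike_cycleGraph_six.of_iso f

theorem isPlaneLike_of_isDisjointUnionOf {V : Type u} {G : SimpleGraph V}
    {𝒞 : ∀ W : Type u, SimpleGraph W → Prop} (h : G.IsDisjointUnionOf 𝒞)
    (h𝒞 : ∀ W H, 𝒞 W H → IsPlaneLike H) : IsPlaneLike G := by
  obtain ⟨ι, W, H, hH, ⟨f⟩⟩ := h
  exact (isPlaneLike_disjointUnion_iff.2 fun i => h𝒞 _ _ (hH i)).of_iso f

end Examples

section Configuration

open Configuration

variable {P L : Type*} [Membership P L]

theorem exists_mem_line_ne {p : P} (h : 1 < lineCount L p) (m : L) : ∃ l : L, p ∈ l ∧ l ≠ m :=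
  Set.exists_ne_of_one_lt_ncard (s := {l : L | p ∈ l}) h m

theorem exists_point_mem_ne {l : L} (h : 1 < pointCount P l) (q : P) : ∃ p : P, p ∈ l ∧ p ≠ q :=
  Set.exists_ne_of_one_lt_ncard (s := {p : P | p ∈ l}) h q

theorem exists_mem_line_ne_ne {p : P} (h : 2 < lineCount L p) (m n : L) :
    ∃ l : L, p ∈ l ∧ l ≠ m ∧ l ≠ n := by
  obtain ⟨l, hpl, hl⟩ := Set.exists_mem_notMem_of_ncard_lt_ncard (s := {m, n})
    (t := {l : L | p ∈ l}) ((Set.ncard_insert_le m {n}).trans_lt (by rwa [Set.ncard_singleton]))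
  simp only [Set.mem_insert_iff, Set.mem_singleton_iff, not_or] at hl
  exact ⟨l, hpl, hl⟩

theorem nondegenerate_of_one_lt
    (hunique : ∀ {p q : P} {l m : L}, p ∈ l → q ∈ l → p ∈ m → q ∈ m → p = q ∨ l = m)
    (hlines : ∀ p : P, 1 < lineCount L p) (hpoints : ∀ l : L, 1 < pointCount P l) :
    Nondegenerate P L where
  eq_or_eq := hunique
  exists_point l := by
    obtain ⟨p, hpl⟩ := Set.nonempty_of_ncard_ne_zero (s := {p : P | p ∈ l}) (hpoints l).ne_bot
    obtain ⟨m, hpm, hml⟩ := exists_mem_line_ne (hlines p) l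
    obtain ⟨q, hqm, hqp⟩ := exists_point_mem_ne (hpoints m) p
    exact ⟨q, fun hql => (hunique hpl hql hpm hqm).elim hqp.symm hml.symm⟩
  exists_line p := by
    obtain ⟨l, hpl⟩ := Set.nonempty_of_ncard_ne_zero (s := {l : L | p ∈ l}) (hlines p).ne_bot
    obtain ⟨q, hql, hqp⟩ := exists_point_mem_ne (hpoints l) p
    obtain ⟨m, hqm, hml⟩ := exists_mem_line_ne (hlines q) l
    exact ⟨m, fun hpm => (hunique hpl hql hpm hqm).elim hqp.symm hml.symm⟩

theorem exists_config_of_two_lt [HasLines P L] [Nonempty P]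
    (hlines : ∀ p : P, 2 < lineCount L p) (hpoints : ∀ l : L, 1 < pointCount P l) :
    ∃ (p₁ p₂ p₃ : P) (l₁ l₂ l₃ : L), p₁ ∉ l₂ ∧ p₁ ∉ l₃ ∧ p₂ ∉ l₁ ∧ p₂ ∈ l₂ ∧ p₂ ∈ l₃ ∧
      p₃ ∉ l₁ ∧ p₃ ∈ l₂ ∧ p₃ ∉ l₃ := by
  have hmeet {p q : P} {l m : L} (hqp : q ≠ p) (hlm : l ≠ m) (hpl : p ∈ l) (hpm : p ∈ m)
      (hql : q ∈ l) : q ∉ m := fun hqm =>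
    (Nondegenerate.eq_or_eq hpl hql hpm hqm).elim hqp.symm hlm
  obtain ⟨p₂⟩ := ‹Nonempty P›
  obtain ⟨l₂, h₂₂⟩ := Set.nonempty_of_ncard_ne_zero (s := {l : L | p₂ ∈ l}) (hlines p₂).ne_bot
  obtain ⟨l₃, h₂₃, h₃₂⟩ := exists_mem_line_ne (one_lt_two.trans (hlines p₂)) l₂
  obtain ⟨l, h₂l, hl₂, hl₃⟩ := exists_mem_line_ne_ne (hlines p₂) l₂ l₃
  obtain ⟨p₃, h₃₂', hp₃₂⟩ := exists_point_mem_ne (hpoints l₂) p₂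
  obtain ⟨p₁, h₁l, hp₁₂⟩ := exists_point_mem_ne (hpoints l) p₂
  have h₁₂ : p₁ ∉ l₂ := hmeet hp₁₂ hl₂ h₂l h₂₂ h₁l
  have hp₁₃ : p₁ ≠ p₃ := (h₁₂ <| · ▸ h₃₂')
  obtain ⟨l₁, h₁₁, hl₁, hl₁'⟩ :=
    exists_mem_line_ne_ne (hlines p₁) (HasLines.mkLine hp₁₂ : L) (HasLines.mkLine hp₁₃ : L)
  have hline₂ := HasLines.mkLine_ax (L := L) hp₁₂
  have hline₃ := HasLines.mkLine_ax (L := L) hp₁₃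
  exact ⟨p₁, p₂, p₃, l₁, l₂, l₃, h₁₂, hmeet hp₁₂ hl₃ h₂l h₂₃ h₁l,
    hmeet hp₁₂.symm hl₁.symm hline₂.1 h₁₁ hline₂.2, h₂₂, h₂₃,
    hmeet hp₁₃.symm hl₁'.symm hline₃.1 h₁₁ hline₃.2, h₃₂', hmeet hp₃₂ h₃₂.symm h₂₂ h₂₃ h₃₂'⟩

theorem exists_projectivePlane_order_eq [Finite P] [Finite L] [Nonempty P] {k : ℕ} (hk : 2 < k)
    (hunique : ∀ {p q : P} {l m : L}, p ∈ l → q ∈ l → p ∈ m → q ∈ m → p = q ∨ l = m)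
    (hjoin : ∀ p q : P, p ≠ q → ∃ l : L, p ∈ l ∧ q ∈ l)
    (hmeet : ∀ l m : L, l ≠ m → ∃ p : P, p ∈ l ∧ p ∈ m)
    (hlines : ∀ p : P, lineCount L p = k) (hpoints : ∀ l : L, 1 < pointCount P l) :
    ∃ _ : ProjectivePlane P L, ProjectivePlane.order P L = k - 1 := by
  have hlines_lt (p : P) : 2 < lineCount L p := hk.trans_eq (hlines p).symm
  have hnondeg : Nondegenerate P L :=
    nondegenerate_of_one_lt hunique (fun p => one_lt_two.trans (hlines_lt p)) hpoints
  choose line hline using hjoin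
  choose point hpoint using hmeet
  let hasLines : HasLines P L := ⟨fun h => line _ _ h, fun h => hline _ _ h⟩
  let plane : ProjectivePlane P L :=
    { hasLines with
      mkPoint := fun h => point _ _ h
      mkPoint_ax := fun h => hpoint _ _ h
      exists_config := exists_config_of_two_lt hlines_lt hpoints }
  obtain ⟨p⟩ := ‹Nonempty P›
  exact ⟨plane, Nat.eq_sub_of_add_eq <|
    (ProjectivePlane.lineCount_eq (L := L) p).symm.trans (hlines p)⟩

theorem exists_equiv_mem_iff_ne [Nondegenerate P L] [Fintype P] [Fintype L]
    (hcard : Fintype.card L = Fintype.card P)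
    (hpoints : ∀ l : L, pointCount P l + 1 = Fintype.card P) :
    ∃ e : L ≃ P, ∀ p l, p ∈ l ↔ p ≠ e l := by
  obtain ⟨f, hf, hfl⟩ := Nondegenerate.exists_injective_of_card_le (P := P) (L := L) hcard.le
  have hbij : f.Bijective := (Fintype.bijective_iff_injective_and_card f).2 ⟨hf, hcard⟩
  refine ⟨.ofBijective f hbij, fun p l => ?_⟩
  have hset : {p : P | p ∈ l} = {f l}ᶜ := by
    refine Set.eq_of_subset_of_ncard_le (fun p hp hpf => hfl l (hpf ▸ hp)) ?_
    have hcompl := Set.ncard_add_ncard_compl {f l}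
    rw [Set.ncard_singleton, Nat.card_eq_fintype_card, ← hpoints l, add_comm] at hcompl
    exact (Nat.add_right_cancel hcompl).le
  exact Set.ext_iff.1 hset p

end Configuration

theorem nonempty_incidenceGraph_iso_cycleGraph_six {P L : Type u} [Membership P L] [Fintype P]
    (hcard : Fintype.card P = 3) (e : L ≃ P) (he : ∀ p l, p ∈ l ↔ p ≠ e l) :
    Nonempty (incidenceGraph P L ≃g cycleGraph 6) := by
  -- Point `i` and line `i` are opposite vertices of the hexagon.
  let hexagon : Fin 3 ⊕ Fin 3 ≃ Fin 6 :=
    .ofBijective (Sum.elim ![0, 2, 4] ![3, 5, 1]) (by decide)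
  have hadj (i j : Fin 3) :
      (cycleGraph 6).Adj (hexagon (.inl i)) (hexagon (.inr j)) ↔ i ≠ j := by
    revert i j
    decide
  have hinl (i j : Fin 3) : ¬(cycleGraph 6).Adj (hexagon (.inl i)) (hexagon (.inl j)) := by
    revert i j
    decide
  have hinr (i j : Fin 3) : ¬(cycleGraph 6).Adj (hexagon (.inr i)) (hexagon (.inr j)) := by
    revert i j
    decide
  let label := Fintype.equivFinOfCardEq hcard
  refine ⟨⟨(Equiv.sumCongr label (e.trans label)).trans hexagon, ?_⟩⟩
  have hmem (p : P) (l : L) :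
      (cycleGraph 6).Adj (hexagon (.inl (label p))) (hexagon (.inr (label (e l)))) ↔ p ∈ l := by
    rw [hadj, he, label.injective.ne_iff]
  rintro (p | l) (q | m)
  · exact iff_of_false (hinl _ _) not_incidenceGraph_adj_inl_inl
  · exact (hmem p m).trans incidenceGraph_adj_inl_inr.symm
  · exact (adj_comm _ _ _).trans ((hmem q l).trans incidenceGraph_adj_inr_inl.symm)
  · exact iff_of_false (hinr _ _) not_incidenceGraph_adj_inr_inr

section Friendship

variable {V : Type*} [Fintype V] {G : SimpleGraph V} [DecidableRel G.Adj] {k : ℕ}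

theorem card_add_of_forall_linked [Nonempty V] (hG : G.IsRegularOfDegree k)
    (h : QuadrilateralFree G) (hlinked : ∀ u v, Linked G u v) :
    Fintype.card V + k = k ^ 2 + 1 := by
  obtain ⟨v⟩ := ‹Nonempty V›
  have hall : {w | Linked G v w} = Set.univ := Set.eq_univ_of_forall (hlinked v)
  have hcard := ncard_linked_add hG h v
  rwa [hall, Set.ncard_univ, Nat.card_eq_fintype_card] at hcard

theorem adjMatrix_pow_of_forall_linked {R : Type*} [Ring R] [DecidableEq V]
    (hG : G.IsRegularOfDegree k) (h : QuadrilateralFree G) (hlinked : ∀ u v, Linked G u v)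
    (hk : (k : R) = 1) {m : ℕ} (hm : 2 ≤ m) : G.adjMatrix R ^ m = Matrix.of fun _ _ => 1 := by
  induction m, hm using Nat.le_induction with
  | base =>
    rw [sq, adjMatrix_mul_self_of_regular R hG h, hk, sub_self, zero_smul, add_zero]
    ext u v
    simp only [relMatrix, Matrix.of_apply, if_pos (hlinked u v)]
  | succ m _ ih =>
    rw [pow_succ', ih]
    ext u v
    simp only [adjMatrix_mul_apply, Matrix.of_apply, Finset.sum_const,
      card_neighborFinset_eq_degree, hG.degree_eq, nsmul_eq_mul, hk, mul_one]

theorem eq_two_of_forall_linked [Nonempty V] (hG : G.IsRegularOfDegree k)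
    (h : QuadrilateralFree G) (hlinked : ∀ u v, Linked G u v) (hk : 2 ≤ k) : k = 2 := by
  classical
  by_contra hne
  -- Modulo a prime divisor of `k - 1` the all-ones matrix is a power of the trace-zero matrix `A`.
  obtain ⟨p, hp, hpk⟩ := Nat.exists_prime_and_dvd (show k - 1 ≠ 1 by omega)
  have : Fact p.Prime := ⟨hp⟩
  have hk1 : (k : ZMod p) = 1 := by
    rwa [← ZMod.natCast_eq_zero_iff, Nat.cast_sub (by omega), Nat.cast_one, sub_eq_zero] at hpk
  have hcard : (Fintype.card V : ZMod p) = 1 := by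
    have := congrArg (Nat.cast (R := ZMod p)) (card_add_of_forall_linked hG h hlinked)
    rwa [Nat.cast_add, Nat.cast_add, Nat.cast_pow, hk1, one_pow, Nat.cast_one,
      add_left_inj] at this
  have htrace := ZMod.trace_pow_card (G.adjMatrix (ZMod p))
  rw [adjMatrix_pow_of_forall_linked hG h hlinked hk1 hp.two_le, trace_adjMatrix,
    zero_pow hp.ne_zero] at htrace
  simp only [Matrix.trace, Matrix.diag_apply, Matrix.of_apply, Finset.sum_const, Finset.card_univ,
    nsmul_eq_mul, hcard, mul_one, one_ne_zero] at htrace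

theorem nonempty_iso_cycleGraph_three_of_forall_linked [Nonempty V] (hG : G.IsRegularOfDegree 2)
    (h : QuadrilateralFree G) (hlinked : ∀ u v, Linked G u v) :
    Nonempty (G ≃g cycleGraph 3) := by
  have hcard : Fintype.card V = 3 :=
    Nat.add_right_cancel (card_add_of_forall_linked hG h hlinked)
  have htop : G = ⊤ := eq_top_iff_forall_isUniversal.2 fun v =>
    (G.degree_eq_card_sub_one v).1 (by rw [hG.degree_eq, hcard])
  rw [htop, cycleGraph_three_eq_top]
  exact ⟨Iso.completeGraph (Fintype.equivFinOfCardEq hcard)⟩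

end Friendship

section Incidence

open Configuration

variable {V P L : Type u} [Membership P L] {G : SimpleGraph V} {k : ℕ}

variable [Fintype V] [DecidableRel G.Adj]

theorem lineCount_eq_of_iso (hG : G.IsRegularOfDegree k) (f : G ≃g incidenceGraph P L) (p : P) :
    lineCount L p = k := by
  obtain ⟨v, hv⟩ := f.surjective (.inl p)
  calc lineCount L p
      = ((incidenceGraph P L).commonNeighbors (f v) (f v)).ncard := by
        simp only [hv, commonNeighbors_incidenceGraph_inl_inl, and_self,
          Set.ncard_image_of_injective _ Sum.inr_injective]
        rfl
    _ = k := by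
        rw [commonNeighbors_apply_iso, Set.ncard_image_of_injective _ f.injective,
          ncard_commonNeighbors_self, hG.degree_eq]

theorem pointCount_eq_of_iso (hG : G.IsRegularOfDegree k) (f : G ≃g incidenceGraph P L) (l : L) :
    pointCount P l = k := by
  obtain ⟨v, hv⟩ := f.surjective (.inr l)
  calc pointCount P l
      = ((incidenceGraph P L).commonNeighbors (f v) (f v)).ncard := by
        simp only [hv, commonNeighbors_incidenceGraph_inr_inr, and_self,
          Set.ncard_image_of_injective _ Sum.inl_injective]
        rfl
    _ = k := by
        rw [commonNeighbors_apply_iso, Set.ncard_image_of_injective _ f.injective,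
          ncard_commonNeighbors_self, hG.degree_eq]

theorem card_lines_eq_card_points_of_iso [Fintype P] [Fintype L] (hG : G.IsRegularOfDegree k)
    (hk : 0 < k) (f : G ≃g incidenceGraph P L) : Fintype.card L = Fintype.card P := by
  have hcount := sum_lineCount_eq_sum_pointCount P L
  simp only [lineCount_eq_of_iso hG f, pointCount_eq_of_iso hG f, Finset.sum_const,
    Finset.card_univ, smul_eq_mul] at hcount
  exact (Nat.eq_of_mul_eq_mul_right hk hcount).symm

theorem card_points_add_of_iso [Fintype P] [Nonempty P] (hG : G.IsRegularOfDegree k)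
    (h : QuadrilateralFree G) (f : G ≃g incidenceGraph P L)
    (hpoints : ∀ p q : P, Linked (incidenceGraph P L) (.inl p) (.inl q)) :
    Fintype.card P + k = k ^ 2 + 1 := by
  obtain ⟨p⟩ := ‹Nonempty P›
  obtain ⟨v, hv⟩ := f.surjective (.inl p)
  have hclass : f '' {w | Linked G v w} = Set.range Sum.inl := by
    ext y
    obtain ⟨w, rfl⟩ := f.surjective y
    rw [f.injective.mem_set_image, Set.mem_ofPred_eq, ← linked_apply_iso f, hv]
    rcases f w with q | l
    · exact iff_of_true (hpoints p q) ⟨q, rfl⟩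
    · exact iff_of_false not_linked_incidenceGraph_inl_inr (by simp)
  rw [← ncard_linked_add hG h v, ← Set.ncard_image_of_injective _ f.injective, hclass,
    ← Set.image_univ, Set.ncard_image_of_injective _ Sum.inl_injective, Set.ncard_univ,
    Nat.card_eq_fintype_card]

theorem isPlaneIncidenceGraph_of_iso [Finite P] [Finite L] [Nonempty P]
    (hG : G.IsRegularOfDegree k) (hk : 2 < k) (h : QuadrilateralFree G)
    (hpoints : ∀ p q : P, Linked (incidenceGraph P L) (.inl p) (.inl q))
    (hlines : ∀ l m : L, Linked (incidenceGraph P L) (.inr l) (.inr m))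
    (f : G ≃g incidenceGraph P L) : IsPlaneIncidenceGraph (k - 1) V G := by
  obtain ⟨hplane, horder⟩ := exists_projectivePlane_order_eq hk
    (quadrilateralFree_incidenceGraph_iff.1 (h.of_iso f.symm))
    (fun p q => (linked_incidenceGraph_inl_inl.1 (hpoints p q)).resolve_left)
    (fun l m => (linked_incidenceGraph_inr_inr.1 (hlines l m)).resolve_left)
    (lineCount_eq_of_iso hG f)
    (fun l => (one_lt_two.trans hk).trans_eq (pointCount_eq_of_iso hG f l).symm)
  exact ⟨P, L, inferInstance, inferInstance, inferInstance, hplane, horder, ⟨f⟩⟩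

theorem nonempty_iso_cycleGraph_six_of_iso [Finite P] [Finite L] [Nonempty P]
    (hG : G.IsRegularOfDegree 2) (h : QuadrilateralFree G) (f : G ≃g incidenceGraph P L)
    (hpoints : ∀ p q : P, Linked (incidenceGraph P L) (.inl p) (.inl q)) :
    Nonempty (G ≃g cycleGraph 6) := by
  have := Fintype.ofFinite P
  have := Fintype.ofFinite L
  have hnondeg : Nondegenerate P L := nondegenerate_of_one_lt
    (quadrilateralFree_incidenceGraph_iff.1 (h.of_iso f.symm))
    (fun p => one_lt_two.trans_eq (lineCount_eq_of_iso hG f p).symm)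
    (fun l => one_lt_two.trans_eq (pointCount_eq_of_iso hG f l).symm)
  have hcard : Fintype.card P = 3 :=
    Nat.add_right_cancel (card_points_add_of_iso hG h f hpoints)
  obtain ⟨e, he⟩ := exists_equiv_mem_iff_ne
    (card_lines_eq_card_points_of_iso hG two_pos f)
    (fun l => by rw [pointCount_eq_of_iso hG f, hcard])
  exact (nonempty_incidenceGraph_iso_cycleGraph_six hcard e he).map f.trans

end Incidence

section Connected

variable {V : Type u} {G : SimpleGraph V} {k : ℕ} {u v w x : V}

theorem IsPlaneLike.linked_of_adj (h : IsPlaneLike G) (huv : Linked G u v) (huw : G.Adj u w)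
    (hvx : G.Adj v x) : Linked G w x := by
  rcases huv with rfl | ⟨y, huy, hvy⟩
  · exact .of_adj_of_adj huw.symm hvx.symm
  · exact h.linked_trans (.of_adj_of_adj huw.symm (adj_symm _ huy))
      (.of_adj_of_adj (adj_symm _ hvy) hvx.symm)

theorem IsPlaneLike.linked_or_linked (h : IsPlaneLike G) (hG : G.Preconnected) (hvw : G.Adj v w)
    (x : V) : Linked G v x ∨ Linked G w x := by
  obtain ⟨p⟩ := hG v x
  induction p generalizing w with
  | nil => exact Or.inl (.refl _)
  | cons hadj _ ih =>
    refine (ih hadj.symm).symm.imp_right fun hbc => ?_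
    exact h.linked_trans (.of_adj_of_adj hvw.symm hadj.symm) hbc

theorem IsPlaneLike.isBipartiteWith (h : IsPlaneLike G) (hG : G.Preconnected) (hvw : G.Adj v w)
    (hlinked : ¬Linked G v w) :
    G.IsBipartiteWith {x | Linked G v x} {x | Linked G v x}ᶜ where
  disjoint := disjoint_compl_right
  mem_of_adj a b hab := by
    by_cases ha : Linked G v a
    · refine Or.inl ⟨ha, fun hb => hlinked ?_⟩
      exact h.linked_trans hb (h.linked_of_adj ha hvw hab).symm
    · have hwa := (h.linked_or_linked hG hvw a).resolve_left ha
      exact Or.inr ⟨ha, h.linked_of_adj hwa hvw.symm hab⟩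

theorem exists_iso_incidenceGraph {S : Set V} (hS : G.IsBipartiteWith S Sᶜ) :
    ∃ (_ : Membership S ↥Sᶜ) (f : G ≃g incidenceGraph S ↥Sᶜ),
      (∀ p : S, f p = .inl p) ∧ ∀ l : ↥Sᶜ, f l = .inr l := by
  classical
  have not_adj_mem {a b : V} (ha : a ∈ S) (hb : b ∈ S) : ¬G.Adj a b := fun hab =>
    (hS.mem_of_adj hab).elim (fun h => h.2 hb) fun h => h.1 ha
  have not_adj_compl {a b : V} (ha : a ∉ S) (hb : b ∉ S) : ¬G.Adj a b := fun hab =>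
    (hS.mem_of_adj hab).elim (fun h => ha h.1) fun h => hb h.2
  let incidence : Membership S ↥Sᶜ := ⟨fun l p => G.Adj p l⟩
  let f : incidenceGraph S ↥Sᶜ ≃g G :=
    { Equiv.Set.sumCompl S with
      map_rel_iff' := by
        rintro (p | l) (q | m)
        · exact iff_of_false (not_adj_mem p.2 q.2) not_incidenceGraph_adj_inl_inl
        · exact (incidenceGraph_adj_inl_inr (p := p) (l := m)).symm
        · exact (G.adj_comm _ _).trans (incidenceGraph_adj_inr_inl (p := q) (l := l)).symm
        · exact iff_of_false (not_adj_compl l.2 m.2) not_incidenceGraph_adj_inr_inr }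
  exact ⟨incidence, f.symm, fun p => f.symm_apply_apply (.inl p),
    fun l => f.symm_apply_apply (.inr l)⟩

variable [Fintype V] [DecidableRel G.Adj]

theorem IsPlaneLike.isPlaneIncidenceGraph_or_nonempty_iso_cycleGraph_six (h : IsPlaneLike G)
    (hG : G.IsRegularOfDegree k) (hconn : G.Preconnected) (hk : 2 ≤ k) (hvw : G.Adj v w)
    (hlinked : ¬Linked G v w) :
    2 < k ∧ IsPlaneIncidenceGraph (k - 1) V G ∨ k = 2 ∧ Nonempty (G ≃g cycleGraph 6) := by
  set S := {x | Linked G v x}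
  obtain ⟨incidence, f, hfp, hfl⟩ :=
    exists_iso_incidenceGraph (h.isBipartiteWith hconn hvw hlinked)
  have : Nonempty S := ⟨v, .refl v⟩
  have hpoints (p q : S) : Linked (incidenceGraph S ↥Sᶜ) (.inl p) (.inl q) := by
    rw [← hfp, ← hfp, linked_apply_iso]
    exact h.linked_trans p.2.symm q.2
  have hlines (l m : ↥Sᶜ) : Linked (incidenceGraph S ↥Sᶜ) (.inr l) (.inr m) := by
    have hw (x : ↥Sᶜ) : Linked G w x := (h.linked_or_linked hconn hvw x).resolve_left x.2
    rw [← hfl, ← hfl, linked_apply_iso]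
    exact h.linked_trans (hw l).symm (hw m)
  rcases hk.lt_or_eq with hk | rfl
  · exact Or.inl ⟨hk, isPlaneIncidenceGraph_of_iso hG hk h.quadrilateralFree
      hpoints hlines f⟩
  · exact Or.inr ⟨rfl, nonempty_iso_cycleGraph_six_of_iso hG h.quadrilateralFree f hpoints⟩

theorem IsPlaneLike.isPlaneIncidenceGraph_or_isTriangleOrHexagon (h : IsPlaneLike G)
    (hG : G.IsRegularOfDegree k) (hconn : G.Connected) (hk : 2 ≤ k) :
    2 < k ∧ IsPlaneIncidenceGraph (k - 1) V G ∨ k = 2 ∧ IsTriangleOrHexagon V G := by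
  obtain ⟨v⟩ := hconn.nonempty
  obtain ⟨w, hvw⟩ := (G.degree_pos_iff_exists_adj v).1 (hG.degree_eq v ▸ two_pos.trans_le hk)
  by_cases hlinked : Linked G v w
  · have hall (x : V) : Linked G v x := (h.linked_or_linked hconn.preconnected hvw x).elim id
      fun hwx => h.linked_trans hlinked hwx
    have hall_pairs (x y : V) : Linked G x y := h.linked_trans (hall x).symm (hall y)
    have : Nonempty V := ⟨v⟩
    obtain rfl := eq_two_of_forall_linked hG h.quadrilateralFree hall_pairs hk
    exact Or.inr ⟨rfl, Or.inl <|
      nonempty_iso_cycleGraph_three_of_forall_linked hG h.quadrilateralFree hall_pairs⟩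
  · exact (h.isPlaneIncidenceGraph_or_nonempty_iso_cycleGraph_six hG hconn.preconnected hk hvw
      hlinked).imp_right (And.imp_right Or.inr)

end Connected

section Components

variable {V : Type u} (G : SimpleGraph V)

/-- The isomorphism from a graph to the disjoint union of its connected components. -/
def isoDisjointUnionComponents :
    G ≃g disjointUnion fun c : G.ConnectedComponent => G.induce c.supp where
  toFun v := ⟨G.connectedComponentMk v, v, rfl⟩
  invFun x := x.2.1
  left_inv _ := rfl
  right_inv := by
    rintro ⟨_, v, rfl⟩
    rfl
  map_rel_iff' {v w} := by
    have key (c : G.ConnectedComponent) (hc : G.connectedComponentMk w = c) :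
        (⟨_, w, rfl⟩ : Σ c : G.ConnectedComponent, c.supp) = ⟨c, w, hc⟩ := by
      subst hc
      rfl
    refine disjointUnion_adj_mk.trans ⟨?_, fun hvw => ?_⟩
    · rintro ⟨b, hb, hvb⟩
      have : w = b := congrArg (fun x => x.2.1) hb
      exact this ▸ hvb
    · exact ⟨⟨w, ConnectedComponent.sound hvw.symm.reachable⟩, key _ _, hvw⟩

variable {G} {k : ℕ}

theorem IsPlaneLike.isDisjointUnionOf [Fintype V] [DecidableRel G.Adj] (h : IsPlaneLike G)
    (hG : G.IsRegularOfDegree k) (hk : 2 ≤ k) :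
    G.IsDisjointUnionOf (IsPlaneIncidenceGraph (k - 1)) ∨
      k = 2 ∧ G.IsDisjointUnionOf IsTriangleOrHexagon := by
  classical
  let e := isoDisjointUnionComponents G
  have hregular (c : G.ConnectedComponent) : (G.induce c.supp).IsRegularOfDegree k := fun v =>
    (degree_induce_of_neighborSet_subset fun _ => c.mem_supp_of_adj_mem_supp v.2).trans
      (hG.degree_eq v)
  have hplaneLike : ∀ c : G.ConnectedComponent, IsPlaneLike (G.induce c.supp) :=
    isPlaneLike_disjointUnion_iff.1 (h.of_iso e.symm)
  have hclass (c : G.ConnectedComponent) :=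
    (hplaneLike c).isPlaneIncidenceGraph_or_isTriangleOrHexagon (hregular c)
      c.connected_toSimpleGraph hk
  rcases hk.lt_or_eq with hk | rfl
  · exact Or.inl ⟨_, _, _, fun c => ((hclass c).resolve_right fun h => hk.ne' h.1).2, ⟨e⟩⟩
  · exact Or.inr ⟨rfl, _, _, _, fun c => ((hclass c).resolve_left fun h => h.1.false).2, ⟨e⟩⟩

theorem isPlaneLike_iff_isDisjointUnionOf [Fintype V] [DecidableRel G.Adj]
    (hG : G.IsRegularOfDegree k) (hk : 2 ≤ k) :
    IsPlaneLike G ↔ G.IsDisjointUnionOf (IsPlaneIncidenceGraph (k - 1)) ∨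
      k = 2 ∧ G.IsDisjointUnionOf IsTriangleOrHexagon := by
  refine ⟨fun h => h.isDisjointUnionOf hG hk, ?_⟩
  rintro (h | ⟨-, h⟩)
  · exact isPlaneLike_of_isDisjointUnionOf h fun _ _ => isPlaneLike_of_isPlaneIncidenceGraph
  · exact isPlaneLike_of_isDisjointUnionOf h fun _ _ => isPlaneLike_of_isTriangleOrHexagon

end Components

end GraphEnergy

theorem theorem1_general {V : Type u} [Fintype V] [DecidableEq V] (G : SimpleGraph V)
    [DecidableRel G.Adj] (k : ℕ) (hk : 2 ≤ k) (hG : G.IsRegularOfDegree k) :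
    G.energy ≤ (√((k : ℝ) - 1) + 1 / ((k : ℝ) + √((k : ℝ) - 1))) * Fintype.card V ∧
    (G.energy = (√((k : ℝ) - 1) + 1 / ((k : ℝ) + √((k : ℝ) - 1))) * Fintype.card V ↔
      G.IsDisjointUnionOf (SimpleGraph.IsPlaneIncidenceGraph (k - 1)) ∨
      (k = 2 ∧ G.IsDisjointUnionOf SimpleGraph.IsTriangleOrHexagon)) := by
  have hk1 : (0 : ℝ) < k - 1 := sub_pos.2 (Nat.one_lt_cast.2 hk)
  have hs : 0 < √((k : ℝ) - 1) := Real.sqrt_pos.2 hk1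
  have hsk : √((k : ℝ) - 1) ^ 2 = k - 1 := Real.sq_sqrt hk1.le
  exact ⟨GraphEnergy.energy_le hG hs hsk, (GraphEnergy.energy_eq_iff_isPlaneLike hG hs hsk).trans
    (GraphEnergy.isPlaneLike_iff_isDisjointUnionOf hG hk)⟩

theorem theorem1 {V : Type u} [Fintype V] [DecidableEq V] (G : SimpleGraph V)
    [DecidableRel G.Adj] (k n : ℕ) (hk : 2 ≤ k) (hn : k ^ 2 - k + 1 ≤ n)
    (hcard : Fintype.card V = n) (hG : G.IsRegularOfDegree k) :
    G.energy ≤ (√((k : ℝ) - 1) + 1 / ((k : ℝ) + √((k : ℝ) - 1))) * (n : ℝ) ∧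
    (G.energy = (√((k : ℝ) - 1) + 1 / ((k : ℝ) + √((k : ℝ) - 1))) * (n : ℝ) ↔
      G.IsDisjointUnionOf (SimpleGraph.IsPlaneIncidenceGraph (k - 1)) ∨
      (k = 2 ∧ G.IsDisjointUnionOf SimpleGraph.IsTriangleOrHexagon)) := by
  subst hcard
  exact theorem1_general G k hk hG
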